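/- Let $n>40$ and let $d_1\le d_2\le\dots\le d_n$ be integers such that $$d_i>2^i\quad\text{for } 1\le i\le \left\lfloor\tfrac{n-1}{2}\right\rfloor,$$ and, if $n$ is even, also $$d_{\frac{n-2}{2}}>2^{\frac{n-2}{2}}+1 .$$ Let $\mathcal H$ be a hypergraph with $n$ vertices whose hyperedges form a set of subsets of $V(\mathcal H)$, of arbitrary sizes (so there are no repeated hyperedges). Let $\delta_1\le\delta_2\le\dots\le\delta_n$ be its degree sequence, where the degree of a vertex is the number of hyperedges containing it, and suppose that $\delta_i\ge d_i$ for all $1\le i\le n$. Then $\mathcal H$ has a Hamiltonian Berge cycle: there are an ordering $v_1,\dots,v_n$ of all vertices of $\mathcal H$ and distinct hyperedges $e_1,\dots,e_n$ of $\mathcal H$ such that $v_i,v_{i+1}\in e_i$ for all $1\le i\le n$, with indices modulo $n$. -/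

import Mathlib

/-! Hypergraphs are Mathlib's `Hypergraph α`: a vertex set `V ⊆ α` together with a *set* of
hyperedges, each an arbitrary subset of `V`.  So hyperedges are never repeated (the hypergraph is
simple), and there is no restriction on their sizes. -/

universe u

/-- The degree of `v`: the number of hyperedges containing `v`. -/
noncomputable def Hypergraph.degree {α : Type*} (H : Hypergraph α) (v : α) : ℕ :=
  {e : Set α | e ∈ H.edgeSet ∧ v ∈ e}.ncard

/-- `δ 1 ≤ δ 2 ≤ ⋯ ≤ δ n` is the degree sequence of the `n`-vertex hypergraph `H`: the vertices
can be enumerated without repetition as `v 1, …, v n` so that `v i` has degree `δ i`, and `δ` is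
nondecreasing on `{1, …, n}`. -/
def Hypergraph.IsDegreeSequence {α : Type*} (H : Hypergraph α) (n : ℕ) (δ : ℕ → ℕ) : Prop :=
  MonotoneOn δ (Set.Icc 1 n) ∧
    ∃ v : ℕ → α, Set.BijOn v (Set.Icc 1 n) H.vertexSet ∧ ∀ i ∈ Set.Icc 1 n, δ i = H.degree (v i)

/-- `v 0, e 0, v 1, e 1, …, v (t - 1), e (t - 1)` is a Berge cycle of length `t` in `H`: the
vertices are distinct, the hyperedges are distinct, and `e i` contains `v i` and `v (i + 1)`, with
indices modulo `t` (`finRotate t` is the cyclic successor on `Fin t`). As usual `t ≥ 2`, so that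
Berge cycles correspond to the cycles of the incidence graph. -/
structure Hypergraph.IsBergeCycle {α : Type*} (H : Hypergraph α) (t : ℕ)
    (v : Fin t → α) (e : Fin t → Set α) : Prop where
  two_le : 2 ≤ t
  vertex_mem : ∀ i, v i ∈ H.vertexSet
  edge_mem : ∀ i, e i ∈ H.edgeSet
  vertex_injective : Function.Injective v
  edge_injective : Function.Injective e
  left_mem : ∀ i, v i ∈ e i
  right_mem : ∀ i, v (finRotate t i) ∈ e i

/-- `H` is Hamiltonian: some Berge cycle of `H` has every vertex of `H` as a defining vertex. -/
def Hypergraph.IsHamiltonian {α : Type*} (H : Hypergraph α) : Prop :=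
  ∃ (t : ℕ) (v : Fin t → α) (e : Fin t → Set α),
    H.IsBergeCycle t v e ∧ ∀ x ∈ H.vertexSet, ∃ i, v i = x

/-- The integer sequence `(d 1, …, d n)` is `ℕ`-Hamiltonian: every (non-uniform) `n`-vertex
hypergraph whose degree sequence is pointwise at least `(d 1, …, d n)` is Hamiltonian. -/
def IsNHamiltonian (n : ℕ) (d : ℕ → ℤ) : Prop :=
  ∀ (α : Type u) (H : Hypergraph α), H.vertexSet.Finite → H.vertexSet.ncard = n →
    ∀ δ : ℕ → ℕ, H.IsDegreeSequence n δ →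
      (∀ i ∈ Set.Icc 1 n, d i ≤ (δ i : ℤ)) → H.IsHamiltonian

/-! Enlarge the hyperedge family until it is maximal without a Hamiltonian Berge cycle; degrees only
grow. Adding a missing set `S` then creates a cycle through `S`, so a Hamiltonian Berge path joins
two vertices of `S`. Hence every missing pair is the pair of ends of such a path, and a set all of
whose pairs are present is itself present.

On a path, call two vertices linked if they coincide or share a hyperedge unused by the path. Let
`a` and `b` be the sizes of `startSet` and `endSet`. Pósa's crossing argument gives `a + b ≤ n - 1`.
Unused hyperedges at `v 0` consist of linked vertices, so there are at most `2 ^ a`; used ones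
number at most `n - 1 - b`. Thus a large degree forces a large `a`. The key point is
`deg_le_two_pow`: if `a + b = n - 1`, used hyperedges give no excess over `2 ^ a`. A used hyperedge
leaving the linked set could be replaced on the path, and once unused it would close a cycle. If
both ends have degree above `2 ^ ((n - 1) / 2)`, only even `n` with `a = b = (n - 2) / 2` survives;
there one index is in neither set, and `false_of_le_deg` excludes this when both degrees are at
least `2 ^ a + 2`.

In the maximal family, take a missing pair whose smaller degree is largest. The vertices of greater
degree form a complete part `K`. Either some path runs from a vertex of this degree into `K`
(`false_of_complete`), or both ends of some path have large degree (`false_of_large_deg`). -/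

namespace BergeCycles

/-! ### Berge paths and the rotations that close them -/

variable {V : Type*} {E : Finset (Finset V)} {n : ℕ}

/-- `v 0, e 0, v 1, …, e (n - 2), v (n - 1)` is a Berge path with hyperedges from `E`. -/
structure IsBergePath (E : Finset (Finset V)) (n : ℕ) (v : ℕ → V) (e : ℕ → Finset V) : Prop where
  inj : ∀ i < n, ∀ j < n, v i = v j → i = j
  edge_inj : ∀ i, i + 1 < n → ∀ j, j + 1 < n → e i = e j → i = j
  mem : ∀ i, i + 1 < n → e i ∈ E
  left : ∀ i, i + 1 < n → v i ∈ e i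
  right : ∀ i, i + 1 < n → v (i + 1) ∈ e i

/-- The hyperedge `g` is not one of the defining hyperedges of a path on `n` vertices. -/
def Avoids (n : ℕ) (e : ℕ → Finset V) (g : Finset V) : Prop :=
  ∀ i, i + 1 < n → e i ≠ g

/-- `E` contains a Berge cycle on `n` vertices, presented as a path with a closing hyperedge. -/
def HasCycle (E : Finset (Finset V)) (n : ℕ) : Prop :=
  ∃ v e f, IsBergePath E n v e ∧ f ∈ E ∧ Avoids n e f ∧ v 0 ∈ f ∧ v (n - 1) ∈ f

variable {v : ℕ → V} {e : ℕ → Finset V}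

/-- Reversal of the initial segment `v 0, …, v j`, followed by closing the path. -/
theorem IsBergePath.crossing (P : IsBergePath E n v e) {j : ℕ} (hj : j + 1 < n)
    {f g : Finset V} (hf : f ∈ E) (hg : g ∈ E) (h0 : v 0 ∈ f) (h1 : v (j + 1) ∈ f)
    (hfe : ∀ i, i + 1 < n → i ≠ j → e i ≠ f) (hge : Avoids n e g)
    (hgj : v j ∈ g) (hgn : v (n - 1) ∈ g) (hfg : f ≠ g) : HasCycle E n := by
  refine ⟨fun t => if t ≤ j then v (j - t) else v t,
    fun t => if t < j then e (j - 1 - t) else if t = j then f else e t, g, ⟨?_, ?_, ?_, ?_, ?_⟩,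
    hg, ?_, ?_, ?_⟩
  · intro s hs t ht h
    split_ifs at h <;> have := P.inj _ (by omega) _ (by omega) h <;> omega
  · intro s hs t ht h
    split_ifs at h
    all_goals first
      | omega
      | exact absurd h (hfe _ (by omega) (by omega))
      | exact absurd h.symm (hfe _ (by omega) (by omega))
      | (have := P.edge_inj _ (by omega) _ (by omega) h; omega)
  · intro t ht
    split_ifs
    · exact P.mem _ (by omega)
    · exact hf
    · exact P.mem _ ht
  · intro t ht
    split_ifs <;> first
      | omega
      | exact P.left t ht
      | skip
    · have := P.right (j - 1 - t) (by omega)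
      rwa [show j - 1 - t + 1 = j - t by omega] at this
    · rwa [show j - t = 0 by omega]
  · intro t ht
    split_ifs <;> first
      | omega
      | exact P.right t ht
      | skip
    · have := P.left (j - 1 - t) (by omega)
      rwa [show j - 1 - t = j - (t + 1) by omega] at this ⊢
    · rwa [show t = j by omega]
  · intro t ht
    dsimp only
    split_ifs
    · exact hge _ (by omega)
    · exact hfg
    · exact hge _ ht
  · simpa using hgj
  · have : ¬ n - 1 ≤ j := by omega
    simpa [this] using hgn

/-- Exchange of the segments `v 0, …, v k` and `v (k + 1), …, v i`, followed by closing the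
path. -/
theorem IsBergePath.exchange (P : IsBergePath E n v e) {k i : ℕ} (hk : k + 1 < i) (hi : i + 1 < n)
    {h g : Finset V} (hh : h ∈ E) (hg : g ∈ E) (h0 : v 0 ∈ e i) (hhk : v k ∈ h)
    (hhi : v (i + 1) ∈ h) (hhe : Avoids n e h) (hge : Avoids n e g)
    (hgk : v (k + 1) ∈ g) (hgn : v (n - 1) ∈ g) (hhg : h ≠ g) : HasCycle E n := by
  -- The joins are `e i` from `v i` to `v 0` and `h` from `v k` to `v (i + 1)`; `g` closes the
  -- cycle.
  refine ⟨fun t => if t < i - k then v (k + 1 + t) else if t ≤ i then v (t - (i - k)) else v t,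
    fun t => if t < i - k then e (k + 1 + t) else if t < i then e (t - (i - k)) else
      if t = i then h else e t, g, ⟨?_, ?_, ?_, ?_, ?_⟩, hg, ?_, ?_, ?_⟩
  · intro s hs t ht h
    split_ifs at h <;> have := P.inj _ (by omega) _ (by omega) h <;> omega
  · intro s hs t ht h
    split_ifs at h
    all_goals first
      | omega
      | exact absurd h (hhe _ (by omega))
      | exact absurd h.symm (hhe _ (by omega))
      | (have := P.edge_inj _ (by omega) _ (by omega) h; omega)
  · intro t ht
    split_ifs
    · exact P.mem _ (by omega)
    · exact P.mem _ (by omega)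
    · exact hh
    · exact P.mem _ ht
  · intro t ht
    split_ifs <;> first
      | omega
      | exact P.left _ (by omega)
      | skip
    rw [show t - (i - k) = k by omega]
    exact hhk
  · intro t ht
    split_ifs with a b c d d' d'' <;> first
      | omega
      | exact P.right _ (by omega)
      | skip
    · rw [show t + 1 - (i - k) = 0 by omega, show k + 1 + t = i by omega]
      exact h0
    · rw [show t + 1 - (i - k) = t - (i - k) + 1 by omega]
      exact P.right _ (by omega)
    · rw [show t = i by omega]
      exact hhi
  · intro t ht
    dsimp only
    split_ifs
    · exact hge _ (by omega)
    · exact hge _ (by omega)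
    · exact hhg
    · exact hge _ ht
  · have : 0 < i - k := by omega
    simpa [this] using hgk
  · have h1 : ¬ n - 1 < i - k := by omega
    have h2 : ¬ n - 1 ≤ i := by omega
    simpa [h1, h2] using hgn

theorem IsBergePath.reverse (P : IsBergePath E n v e) :
    IsBergePath E n (fun t => v (n - 1 - t)) (fun t => e (n - 2 - t)) where
  inj i hi j hj h := by have := P.inj _ (by omega) _ (by omega) h; omega
  edge_inj i hi j hj h := by have := P.edge_inj _ (by omega) _ (by omega) h; omega
  mem i hi := P.mem _ (by omega)
  left i hi := by
    have := P.right (n - 2 - i) (by omega)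
    rwa [show n - 2 - i + 1 = n - 1 - i by omega] at this
  right i hi := by
    have := P.left (n - 2 - i) (by omega)
    rwa [show n - 2 - i = n - 1 - (i + 1) by omega] at this ⊢

theorem Avoids.reverse {g : Finset V} (h : Avoids n e g) : Avoids n (fun t => e (n - 2 - t)) g :=
  fun _ _ => h _ (by omega)

theorem avoids_of_reverse {g : Finset V} (h : Avoids n (fun t => e (n - 2 - t)) g) :
    Avoids n e g := fun i hi => by
  have := h (n - 2 - i) (by omega)
  simpa only [show n - 2 - (n - 2 - i) = i by omega] using this

theorem IsBergePath.update (P : IsBergePath E n v e) {i : ℕ} {h : Finset V}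
    (hh : h ∈ E) (hl : v i ∈ h) (hr : v (i + 1) ∈ h) (hhe : Avoids n e h) :
    IsBergePath E n v (Function.update e i h) where
  inj := P.inj
  edge_inj s hs t ht H := by
    by_cases h1 : s = i <;> by_cases h2 : t = i
    · omega
    · subst h1; simp [h2] at H; exact absurd H.symm (hhe _ ht)
    · subst h2; simp [h1] at H; exact absurd H (hhe _ hs)
    · simp [h1, h2] at H; exact P.edge_inj _ hs _ ht H
  mem s hs := by
    by_cases h1 : s = i
    · subst h1; simpa using hh
    · simpa [h1] using P.mem s hs
  left s hs := by
    by_cases h1 : s = i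
    · subst h1; simpa using hl
    · simpa [h1] using P.left s hs
  right s hs := by
    by_cases h1 : s = i
    · subst h1; simpa using hr
    · simpa [h1] using P.right s hs

theorem Avoids.update {g h : Finset V} (hg : Avoids n e g) (hgh : g ≠ h) (i : ℕ) :
    Avoids n (Function.update e i h) g := fun s hs => by
  by_cases h1 : s = i
  · subst h1; simpa using hgh.symm
  · simpa [h1] using hg s hs

theorem IsBergePath.avoids_update (P : IsBergePath E n v e) {i : ℕ} (hi : i + 1 < n)
    {h : Finset V} (hhe : Avoids n e h) : Avoids n (Function.update e i h) (e i) := fun s hs => by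
  by_cases h1 : s = i
  · subst h1; simpa using (hhe s hs).symm
  · simp only [ne_eq, h1, not_false_eq_true, Function.update_of_ne]
    exact fun H => h1 (P.edge_inj _ hs _ hi H)

theorem IsBergePath.exists_eq [Fintype V] (P : IsBergePath E n v e) (hn : Fintype.card V = n)
    (x : V) : ∃ i < n, v i = x := by
  classical
  have h : (Finset.range n).image v = Finset.univ := by
    apply Finset.eq_univ_of_card
    rw [Finset.card_image_of_injOn, Finset.card_range, hn]
    intro i hi j hj h
    simp only [Finset.coe_range, Set.mem_Iio] at hi hj
    exact P.inj _ hi _ hj h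
  have hx := Finset.mem_univ x
  rw [← h, Finset.mem_image] at hx
  simpa using hx

/-- A cycle using the additional hyperedge `S` gives a path between two vertices of `S`. -/
theorem exists_path_of_hasCycle_insert [DecidableEq V] {S : Finset V} (hn : 2 ≤ n)
    (hE : ¬ HasCycle E n) (h : HasCycle (insert S E) n) :
    ∃ v e, IsBergePath E n v e ∧ v 0 ∈ S ∧ v (n - 1) ∈ S := by
  obtain ⟨v, e, f, P, hf, hfe, h0, h1⟩ := h
  have key : ∀ i, i + 1 < n → e i ≠ S → e i ∈ E := fun i hi hne =>
    Finset.mem_of_mem_insert_of_ne (P.mem i hi) hne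
  by_cases hfS : f = S
  · subst hfS
    exact ⟨v, e, ⟨P.inj, P.edge_inj, fun i hi => key i hi (hfe i hi), P.left, P.right⟩, h0, h1⟩
  have hfE := Finset.mem_of_mem_insert_of_ne hf hfS
  by_cases hS : ∃ i, i + 1 < n ∧ e i = S
  · obtain ⟨i, hi, rfl⟩ := hS
    -- Rotate the cycle to start just after `S = e i`; the former closing hyperedge `f` becomes an
    -- inner one.
    refine ⟨fun t => if t < n - 1 - i then v (i + 1 + t) else v (t - (n - 1 - i)),
      fun t => if t < n - 2 - i then e (i + 1 + t) else if t = n - 2 - i then f else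
        e (t - (n - 1 - i)), ⟨?_, ?_, ?_, ?_, ?_⟩, ?_, ?_⟩
    · intro s hs t ht h
      split_ifs at h <;> have := P.inj _ (by omega) _ (by omega) h <;> omega
    · intro s hs t ht h
      split_ifs at h
      all_goals first
        | omega
        | exact absurd h (hfe _ (by omega))
        | exact absurd h.symm (hfe _ (by omega))
        | (have := P.edge_inj _ (by omega) _ (by omega) h; omega)
    · intro t ht
      split_ifs
      · exact key _ (by omega) fun H => by have := P.edge_inj _ (by omega) _ (by omega) H; omega
      · exact hfE
      · exact key _ (by omega) fun H => by have := P.edge_inj _ (by omega) _ (by omega) H; omega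
    · intro t ht
      split_ifs <;> first
        | omega
        | exact P.left _ (by omega)
        | skip
      rw [show i + 1 + t = n - 1 by omega]
      exact h1
    · intro t ht
      split_ifs <;> first
        | omega
        | exact P.right _ (by omega)
        | skip
      · rw [show t + 1 - (n - 1 - i) = 0 by omega]
        exact h0
      · rw [show t + 1 - (n - 1 - i) = t - (n - 1 - i) + 1 by omega]
        exact P.right _ (by omega)
    · have : 0 < n - 1 - i := by omega
      simpa [this] using P.right i hi
    · have h2 : ¬ n - 1 < n - 1 - i := by omega
      have h3 : n - 1 - (n - 1 - i) = i := by omega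
      simpa [h2, h3] using P.left i hi
  · push Not at hS
    exact absurd ⟨v, e, f, ⟨P.inj, P.edge_inj, fun i hi => key i hi (hS i hi), P.left, P.right⟩,
      hfE, hfe, h0, h1⟩ hE

end BergeCycles

/-! ### Links to the ends and the crossing argument -/

namespace BergeCycles

variable {V : Type*} {E : Finset (Finset V)} {n : ℕ} {v : ℕ → V} {e : ℕ → Finset V}

/-- `x` and `y` are equal or lie in a common hyperedge that the path does not use. -/
def FreeLinked (E : Finset (Finset V)) (n : ℕ) (e : ℕ → Finset V) (x y : V) : Prop :=
  x = y ∨ ∃ h ∈ E, Avoids n e h ∧ x ∈ h ∧ y ∈ h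

open Classical in
/-- The indices whose successor on the path is linked to the first vertex. -/
noncomputable def startSet (E : Finset (Finset V)) (n : ℕ) (v : ℕ → V) (e : ℕ → Finset V) :
    Finset ℕ :=
  (Finset.range (n - 1)).filter fun k => FreeLinked E n e (v 0) (v (k + 1))

open Classical in
/-- The indices of the path vertices linked to the last vertex. -/
noncomputable def endSet (E : Finset (Finset V)) (n : ℕ) (v : ℕ → V) (e : ℕ → Finset V) :
    Finset ℕ :=
  (Finset.range (n - 1)).filter fun k => FreeLinked E n e (v (n - 1)) (v k)

theorem mem_startSet {k : ℕ} :
    k ∈ startSet E n v e ↔ k + 1 < n ∧ FreeLinked E n e (v 0) (v (k + 1)) := by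
  simp only [startSet, Finset.mem_filter, Finset.mem_range, Nat.lt_sub_iff_add_lt]

theorem mem_endSet {k : ℕ} :
    k ∈ endSet E n v e ↔ k + 1 < n ∧ FreeLinked E n e (v (n - 1)) (v k) := by
  simp only [endSet, Finset.mem_filter, Finset.mem_range, Nat.lt_sub_iff_add_lt]

theorem freeLinked_reverse {x y : V} :
    FreeLinked E n (fun t => e (n - 2 - t)) x y ↔ FreeLinked E n e x y :=
  or_congr_right ⟨fun ⟨h, h1, h2, h3⟩ => ⟨h, h1, avoids_of_reverse h2, h3⟩,
    fun ⟨h, h1, h2, h3⟩ => ⟨h, h1, h2.reverse, h3⟩⟩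

theorem card_startSet_reverse :
    (startSet E n (fun t => v (n - 1 - t)) (fun t => e (n - 2 - t))).card =
      (endSet E n v e).card := by
  refine Finset.card_nbij' (fun k => n - 2 - k) (fun k => n - 2 - k) ?_ ?_ ?_ ?_
  · intro k hk
    simp only [Finset.mem_coe, mem_startSet, mem_endSet, freeLinked_reverse] at hk ⊢
    rw [show n - 2 - k = n - 1 - (k + 1) by omega]
    exact ⟨by omega, by simpa using hk.2⟩
  · intro k hk
    simp only [Finset.mem_coe, mem_startSet, mem_endSet, freeLinked_reverse] at hk ⊢
    refine ⟨by omega, ?_⟩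
    rw [show n - 1 - (n - 2 - k + 1) = k by omega]
    simpa using hk.2
  · intro k hk
    simp only [Finset.mem_coe, mem_startSet] at hk
    dsimp only
    omega
  · intro k hk
    simp only [Finset.mem_coe, mem_endSet] at hk
    dsimp only
    omega

theorem card_endSet_reverse :
    (endSet E n (fun t => v (n - 1 - t)) (fun t => e (n - 2 - t))).card =
      (startSet E n v e).card := by
  refine Finset.card_nbij' (fun k => n - 2 - k) (fun k => n - 2 - k) ?_ ?_ ?_ ?_
  · intro k hk
    simp only [Finset.mem_coe, mem_startSet, mem_endSet, freeLinked_reverse] at hk ⊢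
    rw [show n - 2 - k + 1 = n - 1 - k by omega]
    exact ⟨by omega, by simpa using hk.2⟩
  · intro k hk
    simp only [Finset.mem_coe, mem_startSet, mem_endSet, freeLinked_reverse] at hk ⊢
    refine ⟨by omega, ?_⟩
    rw [show n - 1 - (n - 2 - k) = k + 1 by omega]
    simpa using hk.2
  · intro k hk
    simp only [Finset.mem_coe, mem_endSet] at hk
    dsimp only
    omega
  · intro k hk
    simp only [Finset.mem_coe, mem_startSet] at hk
    dsimp only
    omega

namespace IsBergePath

variable (P : IsBergePath E n v e) (hE : ¬ HasCycle E n)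

include P hE

theorem not_mem_ends {g : Finset V} (hg : g ∈ E) (hge : Avoids n e g) (h0 : v 0 ∈ g) :
    v (n - 1) ∉ g := fun h1 => hE ⟨v, e, g, P, hg, hge, h0, h1⟩

theorem not_freeLinked_ends (hn : 2 ≤ n) : ¬ FreeLinked E n e (v (n - 1)) (v 0) := by
  rintro (h | ⟨g, hg, hge, h1, h0⟩)
  · have := P.inj _ (by omega) _ (by omega) h
    omega
  · exact P.not_mem_ends hE hg hge h0 h1

/-- The crossing at `i` cuts the step from `v i` to `v (i + 1)`, so `e i` itself is available to
join `v 0` to `v (i + 1)`. -/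
theorem not_freeLinked_of_mem {i : ℕ} (hi : i + 1 < n) (h0 : v 0 ∈ e i) :
    ¬ FreeLinked E n e (v (n - 1)) (v i) := by
  rintro (h | ⟨g, hg, hge, h1, h2⟩)
  · have := P.inj _ (by omega) _ (by omega) h
    omega
  · exact hE (P.crossing hi (P.mem i hi) hg h0 (P.right i hi)
      (fun t ht hti H => hti (P.edge_inj _ ht _ hi H)) hge h2 h1 (hge i hi))

theorem not_freeLinked_both {k : ℕ} (hk : k + 1 < n)
    (h0 : FreeLinked E n e (v 0) (v (k + 1))) : ¬ FreeLinked E n e (v (n - 1)) (v k) := by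
  rintro (h | ⟨g, hg, hge, h1, h2⟩)
  · have := P.inj _ (by omega) _ (by omega) h
    omega
  obtain (h | ⟨f, hf, hfe, h3, h4⟩) := h0
  · have := P.inj _ (by omega) _ (by omega) h
    omega
  refine hE (P.crossing hk hf hg h3 h4 (fun t ht _ => hfe t ht) hge h2 h1 ?_)
  rintro rfl
  exact P.not_mem_ends hE hf hfe h3 h1

theorem disjoint_startSet_endSet : Disjoint (startSet E n v e) (endSet E n v e) := by
  rw [Finset.disjoint_left]
  intro k hk hk'
  rw [mem_startSet] at hk
  rw [mem_endSet] at hk'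
  exact P.not_freeLinked_both hE hk.1 hk.2 hk'.2

theorem card_startSet_add_card_endSet_le :
    (startSet E n v e).card + (endSet E n v e).card ≤ n - 1 := by
  classical
  rw [← Finset.card_union_of_disjoint (P.disjoint_startSet_endSet hE), ← Finset.card_range (n - 1)]
  refine Finset.card_le_card fun k hk => ?_
  rw [Finset.mem_union, mem_startSet, mem_endSet] at hk
  rw [Finset.mem_range]
  omega

/-- If the last vertex shares a free hyperedge with the predecessor of a vertex of `e' i`, then
`e' i` cannot be replaced on the path by another free hyperedge through the first vertex. -/
theorem false_of_replace {i j : ℕ} {g h : Finset V} (hi : i + 1 < n) (hj : j + 1 < n)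
    (hh : h ∈ E) (hhe : Avoids n e h) (h0 : v 0 ∈ h) (hhi : v i ∈ h) (hhi' : v (i + 1) ∈ h)
    (he0 : v 0 ∈ e i) (hej : v (j + 1) ∈ e i) (hg : g ∈ E) (hge : Avoids n e g)
    (hgn : v (n - 1) ∈ g) (hgj : v j ∈ g) : False := by
  have hgh : g ≠ h := by
    rintro rfl
    exact P.not_mem_ends hE hg hge h0 hgn
  exact hE ((P.update hh hhi hhi' hhe).crossing hj (P.mem i hi) hg he0 hej
    (fun t ht _ => P.avoids_update hi hhe t ht) (hge.update hgh i) hgj hgn (hge i hi))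

end IsBergePath

/-- Any two vertices linked to the first one lie, together with it, in a free hyperedge, after a
possible change of the first hyperedge of the path. -/
def PairLinked (E : Finset (Finset V)) (n : ℕ) (v : ℕ → V) (e : ℕ → Finset V) : Prop :=
  ∀ x y, x < y → y < n → FreeLinked E n e (v 0) (v x) → FreeLinked E n e (v 0) (v y) →
    ∃ e', IsBergePath E n v e' ∧ (∀ k, x = 0 ∨ k ≠ 0 → e' k = e k) ∧
      (∀ g ∈ E, v 0 ∉ g → Avoids n e g → Avoids n e' g) ∧
      ∃ h ∈ E, Avoids n e' h ∧ v 0 ∈ h ∧ v x ∈ h ∧ v y ∈ h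

namespace IsBergePath

variable (P : IsBergePath E n v e) (hE : ¬ HasCycle E n)

include P hE

/-- Walk from `v 0` towards `v i`, staying on vertices linked to the first end and not to the last.
A step to a vertex linked to the last end closes a cycle, and the walk cannot reach `v i`; it must
therefore meet a vertex linked to neither end. -/
theorem exists_gap (hL : PairLinked E n v e) {i : ℕ} (hi : i + 1 < n) (h0 : v 0 ∈ e i)
    (hvi : ¬ FreeLinked E n e (v 0) (v i)) (hvi' : FreeLinked E n e (v 0) (v (i + 1))) :
    ∃ z, z + 1 < n ∧ FreeLinked E n e (v 0) (v z) ∧ ¬ FreeLinked E n e (v (n - 1)) (v z) ∧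
      ¬ FreeLinked E n e (v 0) (v (z + 1)) ∧ ¬ FreeLinked E n e (v (n - 1)) (v (z + 1)) := by
  by_contra! H
  have key : ∀ k ≤ i, FreeLinked E n e (v 0) (v k) ∧ ¬ FreeLinked E n e (v (n - 1)) (v k) := by
    intro k
    induction k with
    | zero => exact fun _ => ⟨Or.inl rfl, P.not_freeLinked_ends hE (by omega)⟩
    | succ k ih =>
      intro hk
      obtain ⟨ih1, ih2⟩ := ih (by omega)
      by_cases hC : FreeLinked E n e (v (n - 1)) (v (k + 1))
      · exfalso
        rcases hk.eq_or_lt with rfl | hk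
        · exact P.not_freeLinked_both hE hi hvi' hC
        obtain (h | ⟨g, hg, hge, h1, h2⟩) := hC
        · have := P.inj _ (by omega) _ (by omega) h
          omega
        -- Here `e' i = e i` because `i ≠ 0`, so `e i` still leads from `v i` back to `v 0` in the
        -- exchange.
        obtain ⟨e', P', hee', hav, h, hh, hhe, h3, h4, h5⟩ :=
          hL k (i + 1) (by omega) hi ih1 hvi'
        have hg0 : v 0 ∉ g := fun h0 => P.not_mem_ends hE hg hge h0 h1
        refine hE (P'.exchange hk hi hh hg ?_ h4 h5 hhe (hav g hg hg0 hge) h2 h1 ?_)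
        · rwa [hee' i (Or.inr (by omega))]
        · rintro rfl
          exact hg0 h3
      · by_cases hA : FreeLinked E n e (v 0) (v (k + 1))
        · exact ⟨hA, hC⟩
        · exact absurd (H k (by omega) ih1 ih2 hA) hC
  exact hvi (key i le_rfl).1

end IsBergePath

/-! ### Counting sets through a vertex -/

/-- A large family of subsets of `B` has a member containing a given subset `Q`. -/
theorem exists_superset_of_card_lt [DecidableEq V] {B Q : Finset V} {U : Finset (Finset V)}
    (hQ : Q ⊆ B) (hU : ∀ S ∈ U, S ⊆ B) (hc : 2 ^ B.card < U.card + 2 ^ (B.card - Q.card)) :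
    ∃ S ∈ U, Q ⊆ S := by
  by_contra! H
  have hd : Disjoint U (Finset.Icc Q B) := by
    rw [Finset.disjoint_left]
    intro S hS hS'
    exact H S hS (Finset.mem_Icc.1 hS').1
  have h1 : (U ∪ Finset.Icc Q B).card ≤ B.powerset.card := by
    refine Finset.card_le_card fun S hS => ?_
    rw [Finset.mem_powerset]
    rcases Finset.mem_union.1 hS with hS | hS
    · exact hU S hS
    · exact (Finset.mem_Icc.1 hS).2
  rw [Finset.card_union_of_disjoint hd, Finset.card_Icc_finset hQ, Finset.card_powerset] at h1
  omega

/-- A large family of subsets of `A` through `u` has a member containing a given set `Q`. -/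
theorem exists_superset_through [DecidableEq V] {A Q : Finset V} {u : V} {U : Finset (Finset V)}
    (hQ : Q ⊆ A.erase u) (hU : ∀ S ∈ U, S ⊆ A ∧ u ∈ S)
    (hc : 2 ^ (A.erase u).card < U.card + 2 ^ ((A.erase u).card - Q.card)) :
    ∃ S ∈ U, Q ⊆ S := by
  have hinj : (U.image fun S => S.erase u).card = U.card := by
    refine Finset.card_image_of_injOn fun S hS T hT h => ?_
    have := congrArg (insert u) h
    simpa [Finset.insert_erase (hU S hS).2, Finset.insert_erase (hU T hT).2] using this
  obtain ⟨S, hS, hQS⟩ := exists_superset_of_card_lt (U := U.image fun S => S.erase u) hQ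
    (by
      intro S hS
      obtain ⟨T, hT, rfl⟩ := Finset.mem_image.1 hS
      exact Finset.erase_subset_erase u (hU T hT).1) (by rwa [hinj])
  obtain ⟨T, hT, rfl⟩ := Finset.mem_image.1 hS
  exact ⟨T, hT, hQS.trans (Finset.erase_subset u T)⟩

theorem card_le_two_pow_of_subset [DecidableEq V] {A : Finset V} {u : V} {U : Finset (Finset V)}
    (hU : ∀ S ∈ U, S ⊆ A ∧ u ∈ S) : U.card ≤ 2 ^ (A.erase u).card := by
  have hinj : (U.image fun S => S.erase u).card = U.card := by
    refine Finset.card_image_of_injOn fun S hS T hT h => ?_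
    have := congrArg (insert u) h
    simpa [Finset.insert_erase (hU S hS).2, Finset.insert_erase (hU T hT).2] using this
  rw [← hinj, ← Finset.card_powerset]
  refine Finset.card_le_card fun S hS => ?_
  obtain ⟨T, hT, rfl⟩ := Finset.mem_image.1 hS
  exact Finset.mem_powerset.2 (Finset.erase_subset_erase u (hU T hT).1)

end BergeCycles

/-! ### Degree bounds at the ends of a path -/

namespace BergeCycles

variable {V : Type*} {E : Finset (Finset V)} {n : ℕ} {v : ℕ → V} {e : ℕ → Finset V}

variable [Fintype V] [DecidableEq V]

/-- The number of members of `E` containing `x`. -/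
def deg (E : Finset (Finset V)) (x : V) : ℕ := (E.filter (x ∈ ·)).card

open Classical in
/-- The vertices linked to the first one. -/
noncomputable def linkedSet (E : Finset (Finset V)) (n : ℕ) (v : ℕ → V) (e : ℕ → Finset V) :
    Finset V :=
  Finset.univ.filter fun x => FreeLinked E n e (v 0) x

open Classical in
/-- The hyperedges through the first vertex that the path does not use. -/
noncomputable def freeSet (E : Finset (Finset V)) (n : ℕ) (v : ℕ → V) (e : ℕ → Finset V) :
    Finset (Finset V) :=
  E.filter fun h => v 0 ∈ h ∧ Avoids n e h

/-- The indices of the path hyperedges through the first vertex. -/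
def usedSet (n : ℕ) (v : ℕ → V) (e : ℕ → Finset V) : Finset ℕ :=
  (Finset.range (n - 1)).filter fun i => v 0 ∈ e i

omit [DecidableEq V] in
theorem mem_linkedSet {x : V} : x ∈ linkedSet E n v e ↔ FreeLinked E n e (v 0) x := by
  simp [linkedSet]

omit [Fintype V] in
theorem mem_freeSet {h : Finset V} :
    h ∈ freeSet E n v e ↔ h ∈ E ∧ v 0 ∈ h ∧ Avoids n e h := by
  simp [freeSet]

omit [Fintype V] in
theorem mem_usedSet {i : ℕ} : i ∈ usedSet n v e ↔ i + 1 < n ∧ v 0 ∈ e i := by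
  simp only [usedSet, Finset.mem_filter, Finset.mem_range, Nat.lt_sub_iff_add_lt]

theorem subset_linkedSet {h : Finset V} (hh : h ∈ freeSet E n v e) :
    h ⊆ linkedSet E n v e ∧ v 0 ∈ h := by
  rw [mem_freeSet] at hh
  exact ⟨fun x hx => mem_linkedSet.2 (Or.inr ⟨h, hh.1, hh.2.2, hh.2.1, hx⟩), hh.2.1⟩

omit [Fintype V] in
theorem deg_le_card_freeSet_add :
    deg E (v 0) ≤ (freeSet E n v e).card + (usedSet n v e).card := by
  refine le_trans ?_ (Nat.add_le_add_left (Finset.card_image_le (f := e)) _)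
  refine le_trans (Finset.card_le_card fun S hS => ?_) (Finset.card_union_le _ _)
  rw [Finset.mem_filter] at hS
  rw [Finset.mem_union, mem_freeSet, Finset.mem_image]
  by_cases h : Avoids n e S
  · exact Or.inl ⟨hS.1, hS.2, h⟩
  · simp only [Avoids, not_forall, not_not] at h
    obtain ⟨i, hi, rfl⟩ := h
    exact Or.inr ⟨i, mem_usedSet.2 ⟨hi, hS.2⟩, rfl⟩

namespace IsBergePath

section

variable (P : IsBergePath E n v e) (hn : Fintype.card V = n) (h2 : 2 ≤ n)

include P hn h2

theorem card_linkedSet_erase :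
    ((linkedSet E n v e).erase (v 0)).card = (startSet E n v e).card := by
  have : (linkedSet E n v e).erase (v 0) = (startSet E n v e).image fun k => v (k + 1) := by
    ext x
    rw [Finset.mem_erase, mem_linkedSet, Finset.mem_image]
    constructor
    · rintro ⟨hx, hl⟩
      obtain ⟨i, hi, rfl⟩ := P.exists_eq hn x
      rcases i with _ | k
      · exact absurd rfl hx
      · exact ⟨k, mem_startSet.2 ⟨hi, hl⟩, rfl⟩
    · rintro ⟨k, hk, rfl⟩
      rw [mem_startSet] at hk
      refine ⟨fun h => ?_, hk.2⟩
      have := P.inj _ hk.1 _ (by omega) h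
      omega
  rw [this]
  refine Finset.card_image_of_injOn fun k hk l hl h => ?_
  rw [Finset.mem_coe, mem_startSet] at hk hl
  have := P.inj _ hk.1 _ hl.1 h
  omega

theorem card_freeSet_le : (freeSet E n v e).card ≤ 2 ^ (startSet E n v e).card := by
  rw [← P.card_linkedSet_erase hn h2]
  exact card_le_two_pow_of_subset fun S hS => subset_linkedSet hS

theorem exists_through {U : Finset (Finset V)} (hU : ∀ S ∈ U, S ⊆ linkedSet E n v e ∧ v 0 ∈ S)
    {x y : ℕ} (hx : 0 < x) (hxy : x < y) (hy : y < n) (hlx : FreeLinked E n e (v 0) (v x))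
    (hly : FreeLinked E n e (v 0) (v y))
    (hc : 2 ^ (startSet E n v e).card < U.card + 2 ^ ((startSet E n v e).card - 2)) :
    ∃ h ∈ U, v 0 ∈ h ∧ v x ∈ h ∧ v y ∈ h := by
  have hne : v x ≠ v y := fun h => hxy.ne (P.inj _ (by omega) _ hy h)
  have hQ : ({v x, v y} : Finset V) ⊆ (linkedSet E n v e).erase (v 0) := by
    intro w hw
    rw [Finset.mem_erase, mem_linkedSet]
    rw [Finset.mem_insert, Finset.mem_singleton] at hw
    rcases hw with rfl | rfl
    · exact ⟨fun h => hx.ne' (P.inj _ (by omega) _ (by omega) h), hlx⟩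
    · exact ⟨fun h => (hx.trans hxy).ne' (P.inj _ hy _ (by omega) h), hly⟩
  obtain ⟨S, hS, hQS⟩ := exists_superset_through hQ hU
    (by rwa [P.card_linkedSet_erase hn h2, Finset.card_pair hne])
  exact ⟨S, hS, (hU S hS).2, hQS (by simp), hQS (by simp)⟩

theorem deg_le_two_pow_of_forall
    (h : ∀ S ∈ E, v 0 ∈ S → S ⊆ linkedSet E n v e) :
    deg E (v 0) ≤ 2 ^ (startSet E n v e).card := by
  rw [← P.card_linkedSet_erase hn h2]
  refine card_le_two_pow_of_subset fun S hS => ?_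
  rw [Finset.mem_filter] at hS
  exact ⟨h S hS.1 hS.2, hS.2⟩

end

section

variable (P : IsBergePath E n v e) (hE : ¬ HasCycle E n)

include P hE

omit [Fintype V] in
theorem card_usedSet_add_card_endSet_le :
    (usedSet n v e).card + (endSet E n v e).card ≤ n - 1 := by
  rw [← Finset.card_union_of_disjoint, ← Finset.card_range (n - 1)]
  · refine Finset.card_le_card fun k hk => ?_
    rw [Finset.mem_union, mem_usedSet, mem_endSet] at hk
    rw [Finset.mem_range]
    omega
  · rw [Finset.disjoint_left]
    intro k hk hk'
    rw [mem_usedSet] at hk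
    rw [mem_endSet] at hk'
    exact P.not_freeLinked_of_mem hE hk.1 hk.2 hk'.2

variable (hn : Fintype.card V = n) (h2 : 2 ≤ n)

include hn h2

/-- The extremal case of the crossing argument: the degree of the first vertex is at most the
number of sets through it that consist of linked vertices. -/
theorem deg_le_two_pow
    (hab : (startSet E n v e).card + (endSet E n v e).card = n - 1) :
    deg E (v 0) ≤ 2 ^ (startSet E n v e).card := by
  by_contra! hd
  -- By equality, the two disjoint index sets partition `{0, …, n - 2}`.
  have hcov : ∀ k, k + 1 < n →
      FreeLinked E n e (v 0) (v (k + 1)) ∨ FreeLinked E n e (v (n - 1)) (v k) := by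
    have hU : startSet E n v e ∪ endSet E n v e = Finset.range (n - 1) := by
      apply Finset.eq_of_subset_of_card_le
      · intro k hk
        rw [Finset.mem_union, mem_startSet, mem_endSet] at hk
        rw [Finset.mem_range]
        omega
      · rw [Finset.card_union_of_disjoint (P.disjoint_startSet_endSet hE), hab,
          Finset.card_range]
    intro k hk
    have : k ∈ startSet E n v e ∪ endSet E n v e := by
      rw [hU, Finset.mem_range]
      omega
    rw [Finset.mem_union, mem_startSet, mem_endSet] at this
    exact this.imp And.right And.right
  have hend : ∀ j, j + 1 < n → ¬ FreeLinked E n e (v 0) (v (j + 1)) →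
      ∃ g ∈ E, Avoids n e g ∧ v (n - 1) ∈ g ∧ v j ∈ g := by
    intro j hj hnot
    refine ((hcov j hj).resolve_left hnot).resolve_left fun h => ?_
    have := P.inj _ (by omega) _ (by omega) h
    omega
  have hfree : ∀ y, 0 < y → y < n → FreeLinked E n e (v 0) (v y) →
      ∃ h ∈ E, Avoids n e h ∧ v 0 ∈ h ∧ v y ∈ h := fun y hy hyn h =>
    h.resolve_left fun h => hy.ne (P.inj _ (by omega) _ hyn h)
  obtain ⟨f, hf, hfe, hf0, hf1⟩ := hfree 1 one_pos (by omega)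
    ((hcov 0 (by omega)).resolve_right (P.not_freeLinked_ends hE h2))
  -- The free hyperedge `f` through `v 0` and `v 1` can replace `e 0`, which would make a vertex of
  -- `e 0` outside the linked set close a cycle.
  have he0 : e 0 ⊆ linkedSet E n v e := by
    intro x hx
    rw [mem_linkedSet]
    obtain ⟨j, hj, rfl⟩ := P.exists_eq hn x
    rcases j with _ | j
    · exact Or.inl rfl
    by_contra hnot
    obtain ⟨g, hg, hge, hgn, hgj⟩ := hend j hj hnot
    exact P.false_of_replace hE (i := 0) (by omega) hj hf hfe hf0 hf0 hf1
      (P.left 0 (by omega)) hx hg hge hgn hgj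
  have hL : PairLinked E n v e := by
    intro x y hxy hyn hlx hly
    rcases Nat.eq_zero_or_pos x with rfl | hx
    · obtain ⟨h, hh, hhe, hh0, hhy⟩ := hfree y hxy hyn hly
      exact ⟨e, P, fun _ _ => rfl, fun _ _ _ h => h, h, hh, hhe, hh0, hh0, hhy⟩
    have hnot : e 0 ∉ freeSet E n v e := fun h =>
      (mem_freeSet.1 h).2.2 0 (by omega) rfl
    have hcard := deg_le_card_freeSet_add (E := E) (n := n) (v := v) (e := e)
    have hused := P.card_usedSet_add_card_endSet_le hE
    have htwo : 2 ≤ (startSet E n v e).card := by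
      rw [← Finset.card_pair (show x - 1 ≠ y - 1 by omega)]
      refine Finset.card_le_card fun k hk => ?_
      rw [Finset.mem_insert, Finset.mem_singleton] at hk
      rw [mem_startSet]
      rcases hk with rfl | rfl
      · rw [Nat.sub_add_cancel hx]
        exact ⟨by omega, hlx⟩
      · rw [Nat.sub_add_cancel (by omega)]
        exact ⟨by omega, hly⟩
    have hpow := Nat.lt_two_pow_self (n := (startSet E n v e).card - 2)
    -- With `a` the size of `startSet`, at most `a` used hyperedges contain `v 0`, so the family has
    -- at least `2 ^ a - (a - 2)` members, and `a - 2 < 2 ^ (a - 2)`. Without `e 0` the count would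
    -- fall one short for `a = 2` and `a = 3`.
    obtain ⟨h, hh, hh0, hhx, hhy⟩ := P.exists_through hn h2
      (U := insert (e 0) (freeSet E n v e)) (by
        intro S hS
        rcases Finset.mem_insert.1 hS with rfl | hS
        · exact ⟨he0, P.left 0 (by omega)⟩
        · exact subset_linkedSet hS) hx hxy hyn hlx hly
      (by rw [Finset.card_insert_of_notMem hnot]; omega)
    rcases Finset.mem_insert.1 hh with rfl | hh
    · refine ⟨Function.update e 0 f, P.update hf hf0 hf1 hfe, fun k hk => ?_, fun g _ hg0 hge =>
        hge.update (by rintro rfl; exact hg0 hf0) 0, e 0, P.mem 0 (by omega),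
        P.avoids_update (by omega) hfe, hh0, hhx, hhy⟩
      rw [Function.update_of_ne (by omega)]
    · rw [mem_freeSet] at hh
      exact ⟨e, P, fun _ _ => rfl, fun _ _ _ h => h, h, hh.1, hh.2.2, hh0, hhx, hhy⟩
  obtain ⟨S, hS, hS0, hSl⟩ : ∃ S ∈ E, v 0 ∈ S ∧ ¬ S ⊆ linkedSet E n v e := by
    by_contra! H
    exact hd.not_ge (P.deg_le_two_pow_of_forall hn h2 H)
  obtain ⟨i, hi, rfl⟩ : ∃ i, i + 1 < n ∧ e i = S := by
    by_contra! H
    exact hSl (subset_linkedSet (mem_freeSet.2 ⟨hS, hS0, H⟩)).1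
  have hi0 : i ≠ 0 := by
    rintro rfl
    exact hSl he0
  obtain ⟨x, hx, hxl⟩ := Finset.not_subset.1 hSl
  obtain ⟨j, hj, rfl⟩ := P.exists_eq hn x
  rw [mem_linkedSet] at hxl
  rcases j with _ | j
  · exact hxl (Or.inl rfl)
  obtain ⟨g, hg, hge, hgn, hgj⟩ := hend j hj hxl
  have hstart : FreeLinked E n e (v 0) (v (i + 1)) :=
    (hcov i hi).resolve_right (P.not_freeLinked_of_mem hE hi hS0)
  by_cases hvi : FreeLinked E n e (v 0) (v i)
  · obtain ⟨e', P', hee', hav, h, hh, hhe, hh0, hhi, hhi'⟩ := hL i (i + 1) (by omega) hi hvi hstart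
    have hei := hee' i (Or.inr hi0)
    exact P'.false_of_replace hE hi hj hh hhe hh0 hhi hhi' (hei ▸ hS0) (hei ▸ hx) hg
      (hav g hg (fun h0 => P.not_mem_ends hE hg hge h0 hgn) hge) hgn hgj
  -- A gap index lies in neither set, against `hcov`.
  · obtain ⟨z, hz, -, h3, h4, -⟩ := P.exists_gap hE hL hi hS0 hvi hstart
    exact (hcov z hz).elim h4 h3

/-- The version of `deg_le_two_pow` for the last vertex. -/
theorem deg_last_le_two_pow
    (hab : (startSet E n v e).card + (endSet E n v e).card = n - 1) :
    deg E (v (n - 1)) ≤ 2 ^ (endSet E n v e).card := by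
  have := P.reverse.deg_le_two_pow hE hn h2
    (by rw [card_startSet_reverse, card_endSet_reverse, add_comm, hab])
  rwa [card_startSet_reverse] at this

end

/-! ### The balanced case for even `n` -/

section

variable (P : IsBergePath E n v e) (hE : ¬ HasCycle E n) (hn : Fintype.card V = n) {m : ℕ}
  (hm : 10 ≤ m) (hnm : n = 2 * m + 2) (ha : (startSet E n v e).card = m)
  (hb : (endSet E n v e).card = m)

include P hE hnm ha hb

omit [Fintype V] [DecidableEq V] in
theorem card_gap_le_one :
    (Finset.range (n - 1) \ (startSet E n v e ∪ endSet E n v e)).card ≤ 1 := by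
  rw [Finset.card_sdiff_of_subset, Finset.card_union_of_disjoint (P.disjoint_startSet_endSet hE),
    Finset.card_range]
  · omega
  · intro k hk
    rw [Finset.mem_union, mem_startSet, mem_endSet] at hk
    rw [Finset.mem_range]
    omega

omit [Fintype V] [DecidableEq V] in
theorem gap_unique {y z : ℕ} (hy : y + 1 < n) (hz : z + 1 < n)
    (hy1 : ¬ FreeLinked E n e (v 0) (v (y + 1))) (hy2 : ¬ FreeLinked E n e (v (n - 1)) (v y))
    (hz1 : ¬ FreeLinked E n e (v 0) (v (z + 1))) (hz2 : ¬ FreeLinked E n e (v (n - 1)) (v z)) :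
    y = z := by
  refine Finset.card_le_one.1 (P.card_gap_le_one hE hnm ha hb) y ?_ z ?_ <;>
    rw [Finset.mem_sdiff, Finset.mem_union, mem_startSet, mem_endSet, Finset.mem_range]
  · exact ⟨by omega, by tauto⟩
  · exact ⟨by omega, by tauto⟩

include hn hm

theorem exists_gap_of_le_deg (hu : 2 ^ m + 2 ≤ deg E (v 0)) (hv : 2 ^ m < deg E (v (n - 1))) :
    ∃ z, z + 1 < n ∧ FreeLinked E n e (v 0) (v z) ∧ ¬ FreeLinked E n e (v (n - 1)) (v z) ∧
      ¬ FreeLinked E n e (v 0) (v (z + 1)) ∧ ¬ FreeLinked E n e (v (n - 1)) (v (z + 1)) := by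
  have h2 : 2 ≤ n := by omega
  -- At most `2 ^ m` hyperedges at `v 0` stay in the linked set, so two leave it. Both are used, at
  -- indices outside `endSet`; at most one index is outside both sets, so one of the two is in
  -- `startSet`.
  obtain ⟨i, hi, hi0, hil, hstart⟩ : ∃ i, i + 1 < n ∧ v 0 ∈ e i ∧ ¬ e i ⊆ linkedSet E n v e ∧
      FreeLinked E n e (v 0) (v (i + 1)) := by
    by_contra! H
    have h1 : ((E.filter (v 0 ∈ ·)).filter (· ⊆ linkedSet E n v e)).card ≤ 2 ^ m := by
      rw [← ha, ← P.card_linkedSet_erase hn h2]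
      refine card_le_two_pow_of_subset fun S hS => ?_
      rw [Finset.mem_filter, Finset.mem_filter] at hS
      exact ⟨hS.2, hS.1.2⟩
    have h3 : ((E.filter (v 0 ∈ ·)).filter (¬ · ⊆ linkedSet E n v e)).card ≤ 1 := by
      refine le_trans (Finset.card_le_card fun S hS => ?_)
        ((Finset.card_image_le (f := e)).trans (P.card_gap_le_one hE hnm ha hb))
      rw [Finset.mem_filter, Finset.mem_filter] at hS
      obtain ⟨i, hi, rfl⟩ : ∃ i, i + 1 < n ∧ e i = S := by
        by_contra! H
        exact hS.2 (subset_linkedSet (mem_freeSet.2 ⟨hS.1.1, hS.1.2, H⟩)).1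
      refine Finset.mem_image_of_mem e ?_
      rw [Finset.mem_sdiff, Finset.mem_union, mem_startSet, mem_endSet, Finset.mem_range]
      have h4 := H i hi hS.1.2 hS.2
      have h5 := P.not_freeLinked_of_mem hE hi hS.1.2
      exact ⟨by omega, by tauto⟩
    have h4 := Finset.card_filter_add_card_filter_not (s := E.filter (v 0 ∈ ·))
      (· ⊆ linkedSet E n v e)
    rw [deg] at hu
    omega
  have hcard := deg_le_card_freeSet_add (E := E) (n := n) (v := v) (e := e)
  have hused := P.card_usedSet_add_card_endSet_le hE
  obtain ⟨q, rfl⟩ : ∃ q, m = q + 2 := ⟨m - 2, by omega⟩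
  have hpow : q + 3 ≤ 2 ^ q := by
    clear * - hm
    induction q, (show 8 ≤ q by omega) using Nat.le_induction with
    | base => norm_num
    | succ k hk ih => have := ih (by omega); rw [pow_succ]; omega
  have hpow1 : 2 ^ (q + 2) = 4 * 2 ^ q := by ring
  have hpow2 : 2 ^ (q + 1) = 2 * 2 ^ q := by ring
  have hpair : ∀ x y, x < y → y < n → FreeLinked E n e (v 0) (v x) →
      FreeLinked E n e (v 0) (v y) →
      ∃ h ∈ E, Avoids n e h ∧ v 0 ∈ h ∧ v x ∈ h ∧ v y ∈ h := by
    intro x y hxy hyn hlx hly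
    rcases Nat.eq_zero_or_pos x with rfl | hx
    · obtain ⟨h, hh, hhe, hh0, hhy⟩ := hly.resolve_left fun h =>
        hxy.ne (P.inj _ (by omega) _ hyn h)
      exact ⟨h, hh, hhe, hh0, hh0, hhy⟩
    obtain ⟨h, hh, hh0, hhx, hhy⟩ := P.exists_through hn h2 (U := freeSet E n v e)
      (fun S hS => subset_linkedSet hS) hx hxy hyn hlx hly
      (by rw [ha, Nat.add_sub_cancel]; omega)
    rw [mem_freeSet] at hh
    exact ⟨h, hh.1, hh.2.2, hh0, hhx, hhy⟩
  by_cases hvi : FreeLinked E n e (v 0) (v i)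
  · exfalso
    obtain ⟨h, hh, hhe, hh0, hhi, hhi'⟩ := hpair i (i + 1) (by omega) hi hvi hstart
    obtain ⟨x, hx, hxl⟩ := Finset.not_subset.1 hil
    obtain ⟨j, hj, rfl⟩ := P.exists_eq hn x
    rw [mem_linkedSet] at hxl
    rcases j with _ | j
    · exact hxl (Or.inl rfl)
    -- The swap frees `e i`, which links the new vertex `v (j + 1)` to `v 0`. Old links survive, so
    -- `a + b` rises to `n - 1` with `b = m`, and the extremal bound at the last vertex contradicts
    -- `hv`.
    have P' := P.update hh hhi hhi' hhe
    have hb' : (endSet E n v e).card ≤ (endSet E n v (Function.update e i h)).card := by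
      refine Finset.card_le_card fun k hk => ?_
      rw [mem_endSet] at hk ⊢
      refine ⟨hk.1, hk.2.imp_right ?_⟩
      rintro ⟨g, hg, hge, hgn, hgk⟩
      refine ⟨g, hg, hge.update ?_ i, hgn, hgk⟩
      rintro rfl
      exact P.not_mem_ends hE hg hge hh0 hgn
    have ha' : (startSet E n v e).card + 1 ≤
        (startSet E n v (Function.update e i h)).card := by
      rw [← Finset.card_insert_of_notMem (a := j) (fun H => hxl (mem_startSet.1 H).2)]
      refine Finset.card_le_card fun k hk => ?_
      rw [mem_startSet]
      rcases Finset.mem_insert.1 hk with rfl | hk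
      · exact ⟨hj, Or.inr ⟨e i, P.mem i hi, P.avoids_update hi hhe, hi0, hx⟩⟩
      rw [mem_startSet] at hk
      refine ⟨hk.1, Or.inr ?_⟩
      have hfh : h ∈ freeSet E n v e := mem_freeSet.2 ⟨hh, hh0, hhe⟩
      obtain ⟨g, hg, hgQ⟩ := exists_superset_through (A := linkedSet E n v e) (u := v 0)
        (U := (freeSet E n v e).erase h) (Q := {v (k + 1)}) (by
          rw [Finset.singleton_subset_iff, Finset.mem_erase, mem_linkedSet]
          refine ⟨fun H => ?_, hk.2⟩
          have := P.inj _ hk.1 _ (by omega) H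
          omega) (fun S hS => subset_linkedSet (Finset.mem_of_mem_erase hS)) (by
          rw [P.card_linkedSet_erase hn h2, ha, Finset.card_singleton,
            Finset.card_erase_of_mem hfh, show q + 2 - 1 = q + 1 by omega]
          omega)
      rw [Finset.mem_erase, mem_freeSet] at hg
      exact ⟨g, hg.2.1, hg.2.2.2.update hg.1 i, hg.2.2.1, Finset.singleton_subset_iff.1 hgQ⟩
    have hab := P'.card_startSet_add_card_endSet_le hE
    have := P'.deg_last_le_two_pow hE hn h2 (by omega)
    rw [show (endSet E n v (Function.update e i h)).card = q + 2 by omega] at this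
    omega
  · exact P.exists_gap hE (fun x y hxy hyn hlx hly =>
      ⟨e, P, fun _ _ => rfl, fun _ _ _ h => h, hpair x y hxy hyn hlx hly⟩) hi hi0 hvi hstart

/-- The unique gap index `z` is found from both ends. Seen from the first end, `v z` is linked to `v
0`; seen from the last, it is linked to neither end. -/
theorem false_of_le_deg (hu : 2 ^ m + 2 ≤ deg E (v 0)) (hv : 2 ^ m + 2 ≤ deg E (v (n - 1))) :
    False := by
  obtain ⟨z, hz, hz1, hz2, hz3, -⟩ :=
    P.exists_gap_of_le_deg hE hn hm hnm ha hb hu (by omega)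
  obtain ⟨y, hy, -, hy2, hy3, hy4⟩ :=
    P.reverse.exists_gap_of_le_deg hE hn hm hnm (by rw [card_startSet_reverse, hb])
      (by rw [card_endSet_reverse, ha]) hv (by simpa using by omega)
  simp only [freeLinked_reverse, Nat.sub_zero, Nat.sub_self] at hy2 hy3 hy4
  rw [show n - 1 - y = n - 2 - y + 1 by omega] at hy2
  rw [show n - 1 - (y + 1) = n - 2 - y by omega] at hy3 hy4
  have := P.gap_unique hE hnm ha hb (by omega) hz hy2 hy3 hz3 hz2
  rw [this] at hy4
  exact hy4 hz1

end

end IsBergePath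

end BergeCycles

/-! ### Maximal families without a Hamiltonian cycle -/

namespace BergeCycles

variable {V : Type*} {E : Finset (Finset V)} {n : ℕ} {v : ℕ → V} {e : ℕ → Finset V}

variable [Fintype V] [DecidableEq V]

theorem hasCycle_univ (hn : Fintype.card V = n) (h3 : 3 ≤ n) :
    HasCycle (Finset.univ : Finset (Finset V)) n := by
  let φ := Fintype.equivFinOfCardEq hn
  let v : ℕ → V := fun i => if h : i < n then φ.symm ⟨i, h⟩ else φ.symm ⟨0, by omega⟩
  have hinj : ∀ i < n, ∀ j < n, v i = v j → i = j := by
    intro i hi j hj h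
    simpa [v, hi, hj] using h
  have hcard : ∀ i, i + 1 < n → ((Finset.range (i + 2)).image v).card = i + 2 := by
    intro i hi
    rw [Finset.card_image_of_injOn, Finset.card_range]
    intro s hs t ht h
    rw [Finset.mem_coe, Finset.mem_range] at hs ht
    exact hinj _ (by omega) _ (by omega) h
  -- Initial segments serve as hyperedges: their sizes differ, and only the last contains `v (n -
  -- 1)`, with `n ≥ 3` elements.
  refine ⟨v, fun i => (Finset.range (i + 2)).image v, {v 0, v (n - 1)}, ⟨hinj, ?_, ?_, ?_, ?_⟩,
    Finset.mem_univ _, ?_, by simp, by simp⟩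
  · intro i hi j hj h
    have := congrArg Finset.card h
    simp only [hcard i hi, hcard j hj] at this
    omega
  · exact fun _ _ => Finset.mem_univ _
  · exact fun i _ => Finset.mem_image_of_mem v (Finset.mem_range.2 (by omega))
  · exact fun i _ => Finset.mem_image_of_mem v (Finset.mem_range.2 (by omega))
  · intro i hi h
    have h1 := hcard i hi
    have h2 : v (n - 1) ∈ (Finset.range (i + 2)).image v := by simp [h]
    obtain ⟨k, hk, hkv⟩ := Finset.mem_image.1 h2
    rw [Finset.mem_range] at hk
    have := hinj _ (by omega) _ (by omega) hkv
    have h4 := Finset.card_le_two (a := v 0) (b := v (n - 1))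
    rw [← h, h1] at h4
    omega

/-- Makes the at most `n - 1` hyperedges of a path negligible; `n > 40` ensures the exponents used
are at least `19`. -/
theorem two_mul_add_five_le_two_pow {q : ℕ} (hq : 19 ≤ q) : 2 * q + 5 ≤ 2 ^ q := by
  induction q, hq using Nat.le_induction with
  | base => norm_num
  | succ k hk ih => rw [pow_succ]; omega

namespace IsBergePath

variable (P : IsBergePath E n v e) (hE : ¬ HasCycle E n)

include P hE

omit [Fintype V] in
theorem pair_ends_notMem (h3 : 3 ≤ n) : ({v 0, v (n - 1)} : Finset V) ∉ E := by
  intro h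
  have hav : ¬ Avoids n e {v 0, v (n - 1)} := fun H => hE ⟨v, e, _, P, h, H, by simp, by simp⟩
  simp only [Avoids, not_forall, not_not] at hav
  obtain ⟨i, hi, he⟩ := hav
  have h1 := P.left i hi
  have h2 := P.right i hi
  rw [he, Finset.mem_insert, Finset.mem_singleton] at h1 h2
  rcases h1 with h1 | h1 <;> rcases h2 with h2 | h2 <;>
    have := P.inj _ (by omega) _ (by omega) h1 <;>
    have := P.inj _ (by omega) _ (by omega) h2 <;> omega

variable (hn : Fintype.card V = n) (h40 : 40 < n)

include hn h40

/-- No path starts at a vertex of large degree and ends in a large set `K` all of whose subsets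
are hyperedges. -/
theorem false_of_complete {K : Finset V} (hK : ∀ S ⊆ K, S ∈ E) (hKv : v (n - 1) ∈ K)
    (hc : n - K.card ≤ (n - 1) / 2) (hd : 2 ^ (n - K.card) < deg E (v 0)) : False := by
  have hKn : K.card ≤ n := hn ▸ Finset.card_le_univ K
  have hb : K.card - 1 ≤ (endSet E n v e).card := by
    rw [← Finset.card_erase_of_mem hKv]
    refine le_trans (Finset.card_le_card fun x hx => ?_) (Finset.card_image_le (f := v))
    obtain ⟨hx, hxK⟩ := Finset.mem_erase.1 hx
    obtain ⟨k, hk, rfl⟩ := P.exists_eq hn x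
    refine Finset.mem_image_of_mem v (mem_endSet.2 ⟨?_, Or.inr ?_⟩)
    · by_contra hk'
      exact hx (by rw [show k = n - 1 by omega])
    have hsub : ({v (n - 1), v k} : Finset V) ⊆ K := by
      intro w hw
      rw [Finset.mem_insert, Finset.mem_singleton] at hw
      rcases hw with rfl | rfl <;> assumption
    by_contra! H
    -- All `2 ^ (K.card - 2)` sets between the pair and `K` are hyperedges, too many to be all used
    -- by the path.
    have h1 : (Finset.Icc {v (n - 1), v k} K).card ≤ n - 1 := by
      rw [← Finset.card_range (n - 1)]
      refine le_trans (Finset.card_le_card fun S hS => ?_) (Finset.card_image_le (f := e))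
      rw [Finset.mem_Icc] at hS
      have hav : ¬ Avoids n e S := fun hav =>
        H S (hK S hS.2) hav (hS.1 (by simp)) (hS.1 (by simp))
      simp only [Avoids, not_forall, not_not] at hav
      obtain ⟨i, hi, rfl⟩ := hav
      exact Finset.mem_image_of_mem e (Finset.mem_range.2 (by omega))
    rw [Finset.card_Icc_finset hsub, Finset.card_pair (Ne.symm hx)] at h1
    have := two_mul_add_five_le_two_pow (q := K.card - 2) (by omega)
    omega
  have hab := P.card_startSet_add_card_endSet_le hE
  have hused := P.card_usedSet_add_card_endSet_le hE
  have hfree := P.card_freeSet_le hn (by omega)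
  have hcard := deg_le_card_freeSet_add (E := E) (n := n) (v := v) (e := e)
  have hK0 : 0 < K.card := Finset.card_pos.2 ⟨_, hKv⟩
  -- A smaller value `≤ q` would give degree at most `2 ^ q + q + 1 ≤ 2 ^ (q + 1)`.
  have ha : (startSet E n v e).card = n - K.card := by
    by_contra hne
    obtain ⟨q, hq⟩ : ∃ q, n - K.card = q + 1 := ⟨n - K.card - 1, by omega⟩
    have h1 : 2 ^ (startSet E n v e).card ≤ 2 ^ q := Nat.pow_le_pow_right (by omega) (by omega)
    have h2 := Nat.lt_two_pow_self (n := q)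
    rw [hq, pow_succ] at hd
    omega
  have := P.deg_le_two_pow hE hn (by omega) (by omega)
  rw [ha] at this
  omega

omit hE in
theorem half_le_card_startSet (hd : 2 ^ ((n - 1) / 2) < deg E (v 0)) :
    (n - 1) / 2 ≤ (startSet E n v e).card := by
  by_contra! h
  have hfree := P.card_freeSet_le hn (by omega)
  have hcard := deg_le_card_freeSet_add (E := E) (n := n) (v := v) (e := e)
  have hused : (usedSet n v e).card ≤ n - 1 :=
    (Finset.card_filter_le _ _).trans (Finset.card_range _).le
  obtain ⟨q, hq⟩ : ∃ q, (n - 1) / 2 = q + 1 := ⟨(n - 1) / 2 - 1, by omega⟩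
  have h1 : 2 ^ (startSet E n v e).card ≤ 2 ^ q := Nat.pow_le_pow_right (by omega) (by omega)
  have h2 := two_mul_add_five_le_two_pow (q := q) (by omega)
  rw [hq, pow_succ] at hd
  omega

/-- No path joins two vertices of large degree. -/
theorem false_of_large_deg (hu : 2 ^ ((n - 1) / 2) < deg E (v 0))
    (hv : 2 ^ ((n - 1) / 2) < deg E (v (n - 1)))
    (hu' : Even n → 2 ^ ((n - 1) / 2) + 2 ≤ deg E (v 0))
    (hv' : Even n → 2 ^ ((n - 1) / 2) + 2 ≤ deg E (v (n - 1))) : False := by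
  have ha := P.half_le_card_startSet hn h40 hu
  have hb := P.reverse.half_le_card_startSet hn h40 (by simpa using hv)
  rw [card_startSet_reverse] at hb
  have hab := P.card_startSet_add_card_endSet_le hE
  -- Both sizes are at least `(n - 1) / 2`. If the sum is `n - 1`, one of them equals this value;
  -- otherwise `n` is even and both do.
  by_cases h : (startSet E n v e).card + (endSet E n v e).card = n - 1
  · rcases ha.eq_or_lt with h1 | h1
    · have := P.deg_le_two_pow hE hn (by omega) h
      rw [← h1] at this
      omega
    · have := P.deg_last_le_two_pow hE hn (by omega) h
      rw [show (endSet E n v e).card = (n - 1) / 2 by omega] at this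
      omega
  · have hev : Even n := Nat.even_iff.2 (by omega)
    exact P.false_of_le_deg hE hn (m := (n - 1) / 2) (by omega) (by omega) (by omega) (by omega)
      (hu' hev) (hv' hev)

end IsBergePath

section

variable (hE : ¬ HasCycle E n) (hmax : ∀ S ∉ E, HasCycle (insert S E) n)

include hE hmax

omit [Fintype V] in
theorem exists_path_of_pair_notMem (h2 : 2 ≤ n) {x y : V} (hxy : ({x, y} : Finset V) ∉ E) :
    ∃ v e, IsBergePath E n v e ∧ v 0 = x ∧ v (n - 1) = y := by
  obtain ⟨v, e, P, h0, h1⟩ := exists_path_of_hasCycle_insert h2 hE (hmax _ hxy)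
  have hne : v 0 ≠ v (n - 1) := fun h => by
    have := P.inj _ (by omega) _ (by omega) h
    omega
  rw [Finset.mem_insert, Finset.mem_singleton] at h0 h1
  rcases h0 with h0 | h0 <;> rcases h1 with h1 | h1
  · exact absurd (h0.trans h1.symm) hne
  · exact ⟨v, e, P, h0, h1⟩
  · exact ⟨_, _, P.reverse, by simpa using h1, by simpa using h0⟩
  · exact absurd (h0.trans h1.symm) hne

omit [Fintype V] in
-- If `S` were missing, a path would join two vertices of `S`, but the pair of ends of a path is
-- never a hyperedge.
theorem mem_of_forall_pair_mem (h3 : 3 ≤ n) {S : Finset V}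
    (hS : ∀ x ∈ S, ∀ y ∈ S, x ≠ y → ({x, y} : Finset V) ∈ E) : S ∈ E := by
  by_contra h
  obtain ⟨v, e, P, h0, h1⟩ := exists_path_of_hasCycle_insert (by omega) hE (hmax _ h)
  refine P.pair_ends_notMem hE h3 (hS _ h0 _ h1 fun h => ?_)
  have := P.inj _ (by omega) _ (by omega) h
  omega

theorem false_of_maximal (hn : Fintype.card V = n) (h40 : 40 < n)
    (hlow : ∀ k, 1 ≤ k → k ≤ (n - 1) / 2 →
      (Finset.univ.filter fun x => deg E x ≤ 2 ^ k).card < k)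
    (hlow' : Even n →
      (Finset.univ.filter fun x => deg E x ≤ 2 ^ ((n - 1) / 2) + 1).card < (n - 1) / 2) :
    False := by
  have hmem := fun {S} => mem_of_forall_pair_mem (S := S) hE hmax (by omega)
  obtain ⟨u, w, huw, hle, hpair⟩ : ∃ u w : V, ({u, w} : Finset V) ∉ E ∧ deg E u ≤ deg E w ∧
      ∀ x y, ({x, y} : Finset V) ∉ E → min (deg E x) (deg E y) ≤ deg E u := by
    let N : Finset (V × V) := Finset.univ.filter fun p => ({p.1, p.2} : Finset V) ∉ E
    have hN : N.Nonempty := by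
      by_contra h
      rw [Finset.not_nonempty_iff_eq_empty, Finset.filter_eq_empty_iff] at h
      refine hE ?_
      rw [(Finset.eq_univ_iff_forall.2 fun S => hmem fun x _ y _ _ =>
        not_not.1 (h (Finset.mem_univ (x, y))) : E = Finset.univ)]
      exact hasCycle_univ hn (by omega)
    obtain ⟨⟨u, w⟩, hp, hpmax⟩ :=
      Finset.exists_max_image N (fun p => min (deg E p.1) (deg E p.2)) hN
    have hp' : ({u, w} : Finset V) ∉ E := (Finset.mem_filter.1 hp).2
    have H : ∀ x y, ({x, y} : Finset V) ∉ E → min (deg E x) (deg E y) ≤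
        min (deg E u) (deg E w) := fun x y h =>
      hpmax (x, y) (Finset.mem_filter.2 ⟨Finset.mem_univ _, h⟩)
    rcases le_total (deg E u) (deg E w) with h | h
    · exact ⟨u, w, hp', h, fun x y hxy => (H x y hxy).trans (min_le_left _ _)⟩
    · exact ⟨w, u, by rwa [Finset.pair_comm], h, fun x y hxy => (H x y hxy).trans (min_le_right _ _)⟩
  set L : Finset V := Finset.univ.filter fun x => deg E x ≤ deg E u
  have hmemL : ∀ {x}, x ∈ L ↔ deg E x ≤ deg E u := by simp [L]
  have hLpos : 0 < L.card := Finset.card_pos.2 ⟨u, hmemL.2 le_rfl⟩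
  have hKc : Lᶜ.card = n - L.card := by rw [Finset.card_compl, hn]
  have hLn : L.card ≤ n := hn ▸ Finset.card_le_univ L
  have hlower : ∀ c k, k ≤ L.card →
      (Finset.univ.filter fun x => deg E x ≤ c).card < k → c < deg E u := by
    intro c k hk hc
    by_contra! h
    refine absurd (hk.trans (Finset.card_le_card fun x hx => ?_)) hc.not_ge
    simpa using (hmemL.1 hx).trans h
  have hclique : ∀ x ∈ Lᶜ, ∀ y ∈ Lᶜ, ({x, y} : Finset V) ∈ E := by
    intro x hx y hy
    rw [Finset.mem_compl, hmemL, not_le] at hx hy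
    by_contra h
    have := hpair x y h
    omega
  by_cases hL : L.card ≤ (n - 1) / 2
  · by_cases hex : ∃ x y, ({x, y} : Finset V) ∉ E ∧ deg E x = deg E u ∧ y ∉ L
    · obtain ⟨x, y, hxy, hx, hy⟩ := hex
      obtain ⟨v, e, P, rfl, rfl⟩ := exists_path_of_pair_notMem hE hmax (by omega) hxy
      refine P.false_of_complete hE hn h40 (K := Lᶜ)
        (fun S hS => hmem fun x hx y hy _ => hclique x (hS hx) y (hS hy))
        (Finset.mem_compl.2 hy) ?_ ?_
      · rw [hKc]
        omega
      · rw [hKc, hx, show n - (n - L.card) = L.card by omega]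
        exact hlower _ _ le_rfl (hlow _ hLpos hL)
    · push Not at hex
      have hw : deg E w = deg E u := le_antisymm (hmemL.1 (hex u w huw rfl)) hle
      -- Now `u` forms a present pair with every vertex of `Lᶜ`, so adding `u` to any subset of `Lᶜ`
      -- gives a hyperedge.
      have hdeg : 2 ^ (n - L.card) ≤ deg E u := by
        rw [← hKc, ← Finset.card_powerset]
        have huL : u ∉ Lᶜ := fun h => Finset.mem_compl.1 h (hmemL.2 le_rfl)
        have huy : ∀ y ∈ Lᶜ, ({u, y} : Finset V) ∈ E := fun y hy => by
          by_contra h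
          exact Finset.mem_compl.1 hy (hex u y h rfl)
        refine Finset.card_le_card_of_injOn (insert u) ?_ ?_
        · intro S hS
          rw [Finset.mem_coe, Finset.mem_powerset] at hS
          rw [Finset.mem_coe, Finset.mem_filter]
          refine ⟨hmem fun x hx y hy hxy => ?_, Finset.mem_insert_self u S⟩
          rcases Finset.mem_insert.1 hx with hxu | hxS <;>
            rcases Finset.mem_insert.1 hy with hyu | hyS
          · exact absurd (hxu.trans hyu.symm) hxy
          · exact hxu ▸ huy y (hS hyS)
          · rw [Finset.pair_comm]
            exact hyu ▸ huy x (hS hxS)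
          · exact hclique x (hS hxS) y (hS hyS)
        · intro S hS T hT h
          rw [Finset.mem_coe, Finset.mem_powerset] at hS hT
          have := congrArg (fun S => S.erase u) h
          simpa [Finset.erase_insert (fun h => huL (hS h)),
            Finset.erase_insert (fun h => huL (hT h))] using this
      have hpow : 2 ^ ((n - 1) / 2 + 1) ≤ 2 ^ (n - L.card) :=
        Nat.pow_le_pow_right (by omega) (by omega)
      have h5 := two_mul_add_five_le_two_pow (q := (n - 1) / 2) (by omega)
      rw [pow_succ] at hpow
      obtain ⟨v, e, P, rfl, rfl⟩ := exists_path_of_pair_notMem hE hmax (by omega) huw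
      exact P.false_of_large_deg hE hn h40 (by omega) (by omega) (fun _ => by omega)
        (fun _ => by omega)
  · have h1 := hlower _ _ (by omega) (hlow ((n - 1) / 2) (by omega) le_rfl)
    have h2 : Even n → 2 ^ ((n - 1) / 2) + 1 < deg E u := fun hev =>
      hlower _ _ (by omega) (hlow' hev)
    obtain ⟨v, e, P, rfl, rfl⟩ := exists_path_of_pair_notMem hE hmax (by omega) huw
    exact P.false_of_large_deg hE hn h40 h1 (h1.trans_le hle) h2
      (fun hev => (h2 hev).trans_le hle)

end

theorem hasCycle_of_deg (hn : Fintype.card V = n) (h40 : 40 < n)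
    (hlow : ∀ k, 1 ≤ k → k ≤ (n - 1) / 2 →
      (Finset.univ.filter fun x => deg E x ≤ 2 ^ k).card < k)
    (hlow' : Even n →
      (Finset.univ.filter fun x => deg E x ≤ 2 ^ ((n - 1) / 2) + 1).card < (n - 1) / 2) :
    HasCycle E n := by
  by_contra hE
  obtain ⟨E', hEE', hE', hmax⟩ := (Set.toFinite {F : Finset (Finset V) | ¬ HasCycle F n}
    ).exists_le_maximal hE
  have hdeg : ∀ x, deg E x ≤ deg E' x := fun x =>
    Finset.card_le_card (Finset.filter_subset_filter _ hEE')
  have hmono : ∀ c, (Finset.univ.filter fun x => deg E' x ≤ c).card ≤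
      (Finset.univ.filter fun x => deg E x ≤ c).card := fun c =>
    Finset.card_le_card fun x hx => by
      simp only [Finset.mem_filter, Finset.mem_univ, true_and] at hx ⊢
      exact (hdeg x).trans hx
  refine false_of_maximal hE' (fun S hS => ?_) hn h40
    (fun k h1 h2 => (hmono _).trans_lt (hlow k h1 h2)) (fun h => (hmono _).trans_lt (hlow' h))
  by_contra h
  exact hS (hmax (y := insert S E') h (Finset.subset_insert S E') (Finset.mem_insert_self S E'))

end BergeCycles

/-! ### Transfer to `Hypergraph` -/

namespace BergeCycles

open Classical in
/-- The hyperedges of `H`, as finite sets of vertices. -/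
noncomputable def edgeFamily {α : Type*} (H : Hypergraph α) [Fintype H.vertexSet] :
    Finset (Finset H.vertexSet) :=
  Finset.univ.filter fun S => Subtype.val '' (S : Set H.vertexSet) ∈ H.edgeSet

theorem mem_edgeFamily {α : Type*} {H : Hypergraph α} [Fintype H.vertexSet]
    {S : Finset H.vertexSet} :
    S ∈ edgeFamily H ↔ Subtype.val '' (S : Set H.vertexSet) ∈ H.edgeSet := by
  simp [edgeFamily]

theorem image_val_injective {α : Type*} {H : Hypergraph α} :
    Function.Injective fun S : Finset H.vertexSet => Subtype.val '' (S : Set H.vertexSet) :=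
  fun _ _ h => Finset.coe_injective (Subtype.val_injective.image_injective h)

theorem deg_edgeFamily {α : Type*} {H : Hypergraph α} [Fintype H.vertexSet]
    [DecidableEq H.vertexSet] (x : H.vertexSet) : deg (edgeFamily H) x = H.degree x := by
  rw [deg, Hypergraph.degree, ← Set.ncard_coe_finset,
    ← Set.ncard_image_of_injective _ (image_val_injective (H := H))]
  congr 1
  ext s
  simp only [Finset.coe_filter, mem_edgeFamily, Set.mem_image, Set.mem_ofPred_eq]
  constructor
  · rintro ⟨S, ⟨hS, hx⟩, rfl⟩
    exact ⟨hS, x, hx, rfl⟩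
  · rintro ⟨hs, hx⟩
    have himg : Subtype.val '' ((Subtype.val ⁻¹' s : Set H.vertexSet).toFinite.toFinset :
        Set H.vertexSet) = s := by
      rw [Set.Finite.coe_toFinset, Subtype.image_preimage_coe]
      exact Set.inter_eq_right.2 (H.subset_vertexSet_of_mem_edgeSet hs)
    exact ⟨_, ⟨by rwa [himg], by simpa using hx⟩, himg⟩

theorem isHamiltonian_of_hasCycle {α : Type*} {H : Hypergraph α} [Fintype H.vertexSet] {n : ℕ}
    (hn : Fintype.card H.vertexSet = n) (h2 : 2 ≤ n) (h : HasCycle (edgeFamily H) n) :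
    H.IsHamiltonian := by
  obtain ⟨v, e, f, P, hf, hfe, h0, h1⟩ := h
  obtain ⟨n, rfl⟩ : ∃ k, n = k + 1 := ⟨n - 1, by omega⟩
  have hlt : ∀ i : Fin (n + 1), i ≠ Fin.last n → (i : ℕ) + 1 < n + 1 := fun i hi => by
    have := Fin.val_lt_last hi
    omega
  let e' : Fin (n + 1) → Finset H.vertexSet := fun i => if i = Fin.last n then f else e i
  refine ⟨n + 1, fun i => v i, fun i => Subtype.val '' (e' i : Set H.vertexSet),
    ⟨h2, fun i => (v i).2, fun i => mem_edgeFamily.1 ?_, fun i j hij => ?_, fun i j hij => ?_,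
    fun i => Set.mem_image_of_mem _ ?_, fun i => Set.mem_image_of_mem _ ?_⟩, fun x hx => ?_⟩
  · by_cases hi : i = Fin.last n
    · simpa [e', hi] using hf
    · simpa [e', hi] using P.mem i (hlt i hi)
  · exact Fin.ext (P.inj i i.2 j j.2 (Subtype.val_injective hij))
  · have hij := image_val_injective hij
    by_cases hi : i = Fin.last n <;> by_cases hj : j = Fin.last n <;>
      simp only [e', hi, hj, if_true, if_false] at hij
    · exact hi.trans hj.symm
    · exact absurd hij.symm (hfe j (hlt j hj))
    · exact absurd hij (hfe i (hlt i hi))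
    · exact Fin.ext (P.edge_inj i (hlt i hi) j (hlt j hj) hij)
  · by_cases hi : i = Fin.last n
    · simpa [e', hi] using h1
    · simpa [e', hi] using P.left i (hlt i hi)
  · by_cases hi : i = Fin.last n
    · subst hi
      simpa [e', finRotate_last] using h0
    · rw [coe_finRotate_of_ne_last hi]
      simpa [e', hi] using P.right i (hlt i hi)
  · obtain ⟨i, hi, hix⟩ := P.exists_eq hn ⟨x, hx⟩
    exact ⟨⟨i, hi⟩, congrArg Subtype.val hix⟩

/-- In the ordering by degree, only the vertices before position `k` can have degree at most `c`. -/
theorem card_deg_le_lt {α : Type*} {H : Hypergraph α} [Fintype H.vertexSet]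
    [DecidableEq H.vertexSet] {n : ℕ} {δ : ℕ → ℕ} (hδ : H.IsDegreeSequence n δ) {c k : ℕ}
    (hk : 1 ≤ k) (hkn : k ≤ n) (hc : c < δ k) :
    (Finset.univ.filter fun x => deg (edgeFamily H) x ≤ c).card < k := by
  classical
  obtain ⟨hmono, v, hv, hdeg⟩ := hδ
  rw [← Finset.card_map (Function.Embedding.subtype (· ∈ H.vertexSet))]
  refine (Finset.card_le_card (t := (Finset.Ico 1 k).image v) fun x hx => ?_).trans_lt ?_
  · obtain ⟨⟨x, hxV⟩, hxc, rfl⟩ := Finset.mem_map.1 hx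
    obtain ⟨i, hi, rfl⟩ := hv.surjOn hxV
    refine Finset.mem_image_of_mem v (Finset.mem_Ico.2 ⟨hi.1, ?_⟩)
    by_contra! hki
    rw [Finset.mem_filter, deg_edgeFamily] at hxc
    have h1 := hmono ⟨hk, hkn⟩ hi hki
    rw [hdeg i hi] at h1
    exact (hc.trans_le h1).not_ge hxc.2
  · refine Finset.card_image_le.trans_lt ?_
    rw [Nat.card_Ico]
    omega

end BergeCycles

theorem theorem3 (n : ℕ) (hn : 40 < n) (d : ℕ → ℤ)
    (hmono : MonotoneOn d (Set.Icc 1 n))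
    (hposa : ∀ i : ℕ, 1 ≤ i → i ≤ (n - 1) / 2 → 2 ^ i < d i)
    (heven : Even n → 2 ^ ((n - 2) / 2) + 1 < d ((n - 2) / 2)) :
    IsNHamiltonian.{u} n d := by
  classical
  intro α H hfin hcard δ hδ hd
  have : Fintype H.vertexSet := hfin.fintype
  have hn' : Fintype.card H.vertexSet = n := by
    rw [← hcard, ← Nat.card_coe_set_eq, Nat.card_eq_fintype_card]
  refine BergeCycles.isHamiltonian_of_hasCycle hn' (by omega)
    (BergeCycles.hasCycle_of_deg hn' hn (fun k h1 h2 => ?_) fun hev => ?_)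
  · refine BergeCycles.card_deg_le_lt hδ h1 (by omega) ?_
    have := (hposa k h1 h2).trans_le (hd k ⟨h1, by omega⟩)
    exact_mod_cast this
  · have hk : (n - 2) / 2 = (n - 1) / 2 := by
      obtain ⟨r, rfl⟩ := hev
      omega
    have := (heven hev).trans_le (hd _ ⟨by omega, by omega⟩)
    rw [hk] at this
    exact BergeCycles.card_deg_le_lt hδ (by omega) (by omega) (by exact_mod_cast this)
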